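/- Consider $n$ agents with nonnegative valuations $\mathbf v=(v_1,\dots,v_n)$ and a supply of $k\ge 1$ identical units; each agent wants one unit, payments are burnt, and the residual surplus of an outcome with winners $A$ and prices $(\pi_i)$ is $\sum_{i\in A}(v_i-\pi_i)$. *Benchmark.* Let $F$ be a probability distribution on $[0,\infty)$ with a density $f$ that is positive exactly on an interval (bounded or unbounded). Put $\vartheta(z)=\frac{1-F(z)}{f(z)}$, $h(q)=\vartheta(F^{-1}(q))$, $H(q)=\int_0^q h(r)\,dr$; let $G$ be the largest convex function on $[0,1)$ bounded above by $H$, let $g$ be the right derivative of $G$ on $[0,1)$, with $g(1)=\lim_{q\uparrow 1}g(q)$, and let $\bar\vartheta(z)=g(F(z))$. The mechanism $\mathrm{Mye}_F$ chooses, uniformly at random, one of the sets $A$ of at most $k$ agents that maximize $\sum_{i\in A}\bar\vartheta(v_i)$; with $x_i(\mathbf v)$ the resulting probability that $i\in A$ and $p_i(\mathbf v)=v_i x_i(\mathbf v)-\int_0^{v_i}x_i(t,\mathbf v_{-i})\,dt$, each winner $i$ pays $p_i(\mathbf v)/x_i(\mathbf v)$ and losers pay nothing. Let $\mathrm{Mye}_F(\mathbf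 v)$ denote its expected residual surplus on $\mathbf v$, and let $\mathcal G(\mathbf v)=\sup_F \mathrm{Mye}_F(\mathbf v)$, the supremum being over all such $F$. *Mechanism.* The $k$-unit $p$-lottery on a set $T$ of agents ($p\ge 0$) sells at price $p$ to the agents of $T$ with valuation greater than $p$; if there are more than $k$ of them, $k$ winners are selected uniformly at random. The $k$-unit Vickrey auction on $T$ serves the $k$ agents of $T$ with the highest valuations, each at a price equal to the $(k+1)$st highest valuation in $T$ ($0$ if there is none). The Random Sampling Optimal Lottery (RSOL) chooses a subset $S_1$ of the $n$ agents uniformly at random and lets $S_2$ be its complement; it lets $p_2\ge 0$ be a price for which the $k$-unit $p_2$-lottery on $S_2$ has maximum expected residual surplus among all prices $p\ge 0$ (such a price exists); and then, with probability $1/2$ each, it runs either the $k$-unit $p_2$-lottery or the $k$-unit Vickrey auction on $S_1$. **Theorem.** There is an absolute constant $\beta>0$ such that for all $n$, all $k\ge 1$, every valuation profile $\mathbf v\in[0,\infty)^n$, and every choice of the optimal prices $p_2$ (as a function of $S_2$), the expected residual surplus of RSOL on $\mathbf v$ is at least $\mathcal G(\mathbf v)/\beta$. -/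

import Mathlib

open scoped BigOperators

noncomputable section

namespace MoneyBurning

/-- A prior on a single valuation: an absolutely continuous probability distribution on `[0, ∞)`
whose density `f` is positive exactly on an interval (bounded or unbounded, open or closed). -/
structure Prior where
  /-- the probability density function -/
  f : ℝ → ℝ
  measurable_f : Measurable f
  f_nonneg : ∀ z, 0 ≤ f z
  interval_support : Set.OrdConnected {z | 0 < f z}
  support_nonneg : ∀ z, 0 < f z → 0 ≤ z
  integrable_f : MeasureTheory.Integrable f
  integral_f : ∫ z, f z = 1

namespace Prior

variable (P : Prior)

/-- The cumulative distribution function `F`. -/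
def F (z : ℝ) : ℝ := ∫ x in Set.Iic z, P.f x

/-- The virtual valuation for utility `ϑ(z) = (1 - F(z)) / f(z)`. -/
def virtualValue (z : ℝ) : ℝ := (1 - P.F z) / P.f z

/-- `F⁻¹`; for `0 < q < 1` this is the unique `z` with `F z = q`. -/
def quantile (q : ℝ) : ℝ := sInf {z : ℝ | 0 ≤ z ∧ q ≤ P.F z}

/-- `h(q) = ϑ(F⁻¹(q))`. -/
def h (q : ℝ) : ℝ := P.virtualValue (P.quantile q)

/-- `H(q) = ∫₀^q h(r) dr`, finite for every `q ∈ [0, 1)`. -/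
def H (q : ℝ) : ℝ := ∫ r in (0 : ℝ)..q, P.h r

/-- The convex hull of `H`: the largest convex function lying below `H`. It is taken on `[0, 1)`,
so that it also makes sense when `H(1) = ∞` (infinite mean); when `H(1)` is finite, this is the
restriction to `[0, 1)` of the convex hull on `[0, 1]`, because `H` is then continuous at `1`. -/
def G (q : ℝ) : ℝ :=
  sSup {y : ℝ | ∃ φ : ℝ → ℝ, ConvexOn ℝ (Set.Ico 0 1) φ ∧
    (∀ r ∈ Set.Ico (0 : ℝ) 1, φ r ≤ P.H r) ∧ y = φ q}

/-- The derivative `g` of `G`, extended by right-continuity on `[0, 1)`, i.e. the right derivative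
of the convex function `G`; at `1` it is the limit from the left of the nondecreasing function `g`.
(The value at `1` is only used when the support is bounded, and then `g` is bounded.) -/
def g (q : ℝ) : ℝ :=
  if q < 1 then derivWithin P.G (Set.Ici q) q
  else sSup ((fun r => derivWithin P.G (Set.Ici r) r) '' Set.Ico (0 : ℝ) 1)

/-- The ironed virtual valuation for utility `g(F(z))`. -/
def ironed (z : ℝ) : ℝ := P.g (P.F z)

end Prior

variable {n : ℕ}

/-- The feasible allocations (sets of at most `k` served agents) which maximize `∑ θ(vᵢ) xᵢ`. -/
def optAllocations (k : ℕ) (θ : ℝ → ℝ) (v : Fin n → ℝ) : Finset (Finset (Fin n)) :=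
  {A : Finset (Fin n) | A.card ≤ k ∧
    ∀ B : Finset (Fin n), B.card ≤ k → ∑ i ∈ B, θ (v i) ≤ ∑ i ∈ A, θ (v i)}

/-- `xᵢ(v)`: the probability that `i` is served when the allocation is drawn uniformly at random
from the maximizing ones. -/
def allocProb (k : ℕ) (θ : ℝ → ℝ) (v : Fin n → ℝ) (i : Fin n) : ℝ :=
  𝔼 A ∈ optAllocations k θ v, if i ∈ A then (1 : ℝ) else 0

/-- The payment rule given by the payment identity
`pᵢ(v) = vᵢ xᵢ(v) - ∫₀^{vᵢ} xᵢ(t, v₋ᵢ) dt`. -/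
def payment (k : ℕ) (θ : ℝ → ℝ) (v : Fin n → ℝ) (i : Fin n) : ℝ :=
  v i * allocProb k θ v i - ∫ t in (0 : ℝ)..v i, allocProb k θ (Function.update v i t) i

/-- `Mye_F(v)`: the expected residual surplus, on the profile `v`, of the mechanism that draws an
allocation uniformly at random from those maximizing the ironed virtual surplus and charges each
winner `i` the price `pᵢ(v) / xᵢ(v)` and each loser `0`. -/
def mye (k : ℕ) (P : Prior) (v : Fin n → ℝ) : ℝ :=
  𝔼 A ∈ optAllocations k P.ironed v,
    ∑ i ∈ A, (v i - payment k P.ironed v i / allocProb k P.ironed v i)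

/-- The benchmark `𝒢(v) = sup_F Mye_F(v)`, as a supremum of extended reals. -/
def benchmark (k : ℕ) (v : Fin n → ℝ) : EReal :=
  ⨆ P : Prior, ((mye k P v : ℝ) : EReal)

/-- The agents of `T` who want to buy at price `p`. -/
def buyers (v : Fin n → ℝ) (T : Finset (Fin n)) (p : ℝ) : Finset (Fin n) :=
  {i ∈ T | p < v i}

/-- The expected residual surplus of the `k`-unit `p`-lottery on the set `T` of agents: the winners,
who pay `p` each, are a uniformly random set of `min k b` of the `b` buyers. -/
def lottery (k : ℕ) (v : Fin n → ℝ) (T : Finset (Fin n)) (p : ℝ) : ℝ :=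
  𝔼 W ∈ (buyers v T p).powersetCard (min k (buyers v T p).card), ∑ i ∈ W, (v i - p)

/-- `p` is the price of an optimal `k`-unit lottery for `T`. -/
def IsOptimalPrice (k : ℕ) (v : Fin n → ℝ) (T : Finset (Fin n)) (p : ℝ) : Prop :=
  0 ≤ p ∧ ∀ p' : ℝ, 0 ≤ p' → lottery k v T p' ≤ lottery k v T p

/-- The valuations of the agents of `T`, in nonincreasing order. -/
def sortedValues (v : Fin n → ℝ) (T : Finset (Fin n)) : List ℝ :=
  (T.val.map v).sort (· ≥ ·)

/-- The residual surplus of the `k`-unit Vickrey auction on `T`: the `k` highest valuations win and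
each winner pays the `(k+1)`-st highest valuation (`0` if there is none). -/
def vickrey (k : ℕ) (v : Fin n → ℝ) (T : Finset (Fin n)) : ℝ :=
  (((sortedValues v T).take k).map fun x => x - (sortedValues v T).getD k 0).sum

/-- The expected residual surplus of the Random Sampling Optimal Lottery, where `price S₂` is the
price computed from the sample `S₂`: `S₁` is a uniformly random subset of the agents and `S₂` its
complement; with probability `1/2` each, the `k`-unit `price S₂`-lottery or the `k`-unit Vickrey
auction is run on `S₁`. -/
def rsol (k : ℕ) (v : Fin n → ℝ) (price : Finset (Fin n) → ℝ) : ℝ :=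
  𝔼 S₁ : Finset (Fin n), (1 / 2 * lottery k v S₁ (price S₁ᶜ) + 1 / 2 * vickrey k v S₁)

/-- Optimal lottery prices exist. -/
theorem exists_isOptimalPrice (k : ℕ) (v : Fin n → ℝ) (T : Finset (Fin n)) :
    ∃ p, IsOptimalPrice k v T p := by
  classical
  let C : Finset ℝ := insert 0 ((T.image v).filter (0 ≤ ·))
  have hC : C.Nonempty := ⟨0, Finset.mem_insert_self _ _⟩
  have hC0 : ∀ c ∈ C, 0 ≤ c := by
    intro c hc
    rcases Finset.mem_insert.1 hc with h | h
    · exact h.ge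
    · exact (Finset.mem_filter.1 h).2
  obtain ⟨p, hpC, hp⟩ := C.exists_max_image (lottery k v T) hC
  refine ⟨p, hC0 p hpC, fun p' hp' => ?_⟩
  have hD : (C.filter (· ≤ p')).Nonempty :=
    ⟨0, Finset.mem_filter.2 ⟨Finset.mem_insert_self _ _, hp'⟩⟩
  obtain ⟨c, hc, hmax⟩ := (C.filter (· ≤ p')).exists_max_image id hD
  obtain ⟨hcC, hcp⟩ := Finset.mem_filter.1 hc
  refine le_trans ?_ (hp c hcC)
  have hb : buyers v T p' = buyers v T c := by
    ext i
    simp only [buyers, Finset.mem_filter, and_congr_right_iff]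
    intro hi
    refine ⟨fun h => lt_of_le_of_lt hcp h, fun h => ?_⟩
    by_contra hcon
    have hmem : v i ∈ C.filter (· ≤ p') := by
      refine Finset.mem_filter.2 ⟨Finset.mem_insert_of_mem (Finset.mem_filter.2
        ⟨Finset.mem_image_of_mem v hi, (hC0 c hcC).trans h.le⟩), not_lt.1 hcon⟩
    exact absurd (hmax _ hmem) (not_le.2 h)
  unfold lottery
  rw [hb]
  refine Finset.expect_le_expect fun W _ => Finset.sum_le_sum fun i _ => ?_
  exact sub_le_sub_left hcp _

end MoneyBurning

end

/-!
`Mye_F` maximizes a virtual surplus for a monotone virtual valuation function. For every such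
function, each agent faces two cutoffs `q` and `p` that do not depend on the agent: a bid below `q`
loses, a bid between `q` and `p` is rationed, and only a bid above `p` may win for sure. Since the
residual surplus of an agent is the integral of the winning probability, the residual surplus of the
mechanism is at most the sum of those of the `p`-lottery and the `q`-lottery.

It remains to compare RSOL with a single lottery. With constant probability the random sample `S₁`
contains the highest agent, and both `S₁` and `S₂` contain a constant fraction of the buyers at
every price below the second highest valuation: the sets of buyers form a chain, so their sizes are
distinct and the Chernoff bounds sum up geometrically. In this event, up to constant
factors, restricting a lottery to `S₂` costs at most the gap between the two highest valuations,
which the Vickrey auction on `S₁` recovers, and the lottery that is optimal for `S₂` does as well on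
`S₁` as on `S₂`.
-/

noncomputable section

namespace MoneyBurning

section Convex

open Set Filter Topology

theorem hasDerivWithinAt_Ici_sInf_slope {S : Set ℝ} {φ : ℝ → ℝ} (hφ : ConvexOn ℝ S φ) {x y : ℝ}
    (hx : x ∈ S) (hxy : x < y) (hS : Ioo x y ⊆ S) (hbdd : BddBelow (slope φ x '' Ioo x y)) :
    HasDerivWithinAt φ (sInf (slope φ x '' Ioo x y)) (Ici x) x := by
  refine HasDerivWithinAt.Ici_of_Ioi ?_
  rw [hasDerivWithinAt_iff_tendsto_slope' self_notMem_Ioi]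
  exact ((hφ.slope_mono hx).mono fun r hr => ⟨hS hr, hr.1.ne'⟩).tendsto_nhdsWithin_Ioo_right
    (nonempty_Ioo.2 hxy) hbdd

end Convex

namespace Prior

open MeasureTheory Set Filter Topology

variable (P : Prior)

/-- The probability measure on `ℝ` with density `f`. -/
def law : Measure ℝ := volume.withDensity fun z => ENNReal.ofReal (P.f z)

theorem law_Iic (z : ℝ) : P.law (Iic z) = ENNReal.ofReal (P.F z) := by
  rw [law, withDensity_apply _ measurableSet_Iic, F,
    ofReal_integral_eq_lintegral_ofReal P.integrable_f.integrableOn (ae_of_all _ P.f_nonneg)]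

instance isProbabilityMeasure_law : IsProbabilityMeasure P.law := by
  constructor
  rw [law, withDensity_apply _ MeasurableSet.univ, setLIntegral_univ,
    ← ofReal_integral_eq_lintegral_ofReal P.integrable_f (ae_of_all _ P.f_nonneg),
    P.integral_f, ENNReal.ofReal_one]

theorem F_eq_cdf : P.F = ProbabilityTheory.cdf P.law := by
  funext z
  rw [ProbabilityTheory.cdf_eq_real, measureReal_def, law_Iic, ENNReal.toReal_ofReal]
  exact setIntegral_nonneg measurableSet_Iic fun x _ => P.f_nonneg x

theorem F_nonneg (z : ℝ) : 0 ≤ P.F z := P.F_eq_cdf ▸ ProbabilityTheory.cdf_nonneg _ z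

theorem F_le_one (z : ℝ) : P.F z ≤ 1 := P.F_eq_cdf ▸ ProbabilityTheory.cdf_le_one _ z

theorem F_mono : Monotone P.F := P.F_eq_cdf ▸ ProbabilityTheory.monotone_cdf _

theorem tendsto_F_atTop : Tendsto P.F atTop (𝓝 1) :=
  P.F_eq_cdf ▸ ProbabilityTheory.tendsto_cdf_atTop _

theorem continuous_F : Continuous P.F := by
  have hF : P.F = fun z => P.F 0 + ∫ x in (0 : ℝ)..z, P.f x := by
    funext z
    rw [← intervalIntegral.integral_Iic_sub_Iic P.integrable_f.integrableOn
      P.integrable_f.integrableOn, F, F, add_sub_cancel]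
  rw [hF]
  exact continuous_const.add
    (intervalIntegral.continuous_primitive (fun a b => P.integrable_f.intervalIntegrable) 0)

theorem F_zero : P.F 0 = 0 := by
  rw [F, integral_Iic_eq_integral_Iio]
  refine setIntegral_eq_zero_of_forall_eq_zero fun x hx => ?_
  by_contra hne
  exact hx.not_ge (P.support_nonneg x ((P.f_nonneg x).lt_of_ne' hne))

theorem nonneg_of_F_pos {z : ℝ} (hz : 0 < P.F z) : 0 ≤ z := by
  by_contra! h
  exact hz.not_ge (P.F_zero ▸ P.F_mono h.le)

theorem quantile_le_iff {q z : ℝ} (hq : q ∈ Ioo (0 : ℝ) 1) : P.quantile q ≤ z ↔ q ≤ P.F z := by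
  have hbdd : BddBelow {z : ℝ | 0 ≤ z ∧ q ≤ P.F z} := ⟨0, fun _ hz => hz.1⟩
  refine ⟨fun hz => ?_, fun hz => csInf_le hbdd ⟨P.nonneg_of_F_pos (hq.1.trans_le hz), hz⟩⟩
  have hclosed : IsClosed {z : ℝ | 0 ≤ z ∧ q ≤ P.F z} :=
    isClosed_Ici.inter (isClosed_Ici.preimage P.continuous_F)
  have hne : {z : ℝ | 0 ≤ z ∧ q ≤ P.F z}.Nonempty :=
    ((eventually_ge_atTop 0).and (P.tendsto_F_atTop.eventually (eventually_ge_nhds hq.2))).exists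
  exact (hclosed.csInf_mem hne hbdd).2.trans (P.F_mono hz)

theorem F_quantile {q : ℝ} (hq : q ∈ Ioo (0 : ℝ) 1) : P.F (P.quantile q) = q := by
  have hle : q ≤ P.F (P.quantile q) := (P.quantile_le_iff hq).1 le_rfl
  obtain ⟨z, hz, hFz⟩ := intermediate_value_Icc (P.nonneg_of_F_pos (hq.1.trans_le hle))
    P.continuous_F.continuousOn ⟨P.F_zero.trans_le hq.1.le, hle⟩
  rw [hz.2.antisymm ((P.quantile_le_iff hq).2 hFz.ge)] at hFz
  exact hFz

theorem monotoneOn_quantile : MonotoneOn P.quantile (Ioo 0 1) := fun _ hq _ hr hqr =>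
  (P.quantile_le_iff hq).2 (hqr.trans (P.F_quantile hr).ge)

theorem aemeasurable_quantile : AEMeasurable P.quantile (volume.restrict (Ioo 0 1)) :=
  aemeasurable_restrict_of_monotoneOn measurableSet_Ioo P.monotoneOn_quantile

theorem map_quantile : (volume.restrict (Ioo 0 1)).map P.quantile = P.law := by
  have : IsFiniteMeasure ((volume.restrict (Ioo (0 : ℝ) 1)).map P.quantile) :=
    Measure.isFiniteMeasure_map _ _
  refine Measure.ext_of_Iic _ _ fun z => ?_
  have hpre : P.quantile ⁻¹' Iic z ∩ Ioo 0 1 = Iic (P.F z) ∩ Ioo 0 1 := by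
    ext q
    exact and_congr_left fun hq => P.quantile_le_iff hq
  rw [Measure.map_apply_of_aemeasurable P.aemeasurable_quantile measurableSet_Iic,
    Measure.restrict_apply' measurableSet_Ioo, hpre, ← Measure.restrict_apply' measurableSet_Ioo,
    restrict_Ioo_eq_restrict_Ioc, Measure.restrict_apply' measurableSet_Ioc, inter_comm,
    Ioc_inter_Iic, min_eq_right (P.F_le_one z), Real.volume_Ioc, sub_zero, law_Iic]

theorem virtualValue_nonneg (z : ℝ) : 0 ≤ P.virtualValue z :=
  div_nonneg (sub_nonneg.2 (P.F_le_one z)) (P.f_nonneg z)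

theorem measurable_virtualValue : Measurable P.virtualValue :=
  (measurable_const.sub P.F_mono.measurable).div P.measurable_f

theorem h_nonneg (q : ℝ) : 0 ≤ P.h q := P.virtualValue_nonneg _

theorem aemeasurable_h : AEMeasurable P.h (volume.restrict (Ioo 0 1)) :=
  P.measurable_virtualValue.comp_aemeasurable P.aemeasurable_quantile

theorem lintegral_h_eq {q : ℝ} (hq : 0 ≤ q) :
    ∫⁻ r in Ioo q 1, ENNReal.ofReal (P.h r) =
      ∫⁻ z in {z | q < P.F z}, ENNReal.ofReal (P.f z * P.virtualValue z) := by
  have hS : MeasurableSet {z | q < P.F z} := measurableSet_lt measurable_const P.F_mono.measurable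
  have hϑ : Measurable fun z => ENNReal.ofReal (P.virtualValue z) :=
    P.measurable_virtualValue.ennreal_ofReal
  set Φ := {z | q < P.F z}.indicator fun z => ENNReal.ofReal (P.virtualValue z) with hΦ
  have hquantile : EqOn ((Ioo q 1).indicator fun r => ENNReal.ofReal (P.h r))
      (fun r => Φ (P.quantile r)) (Ioo 0 1) := fun r hr => by
    simp only [Φ, indicator_apply, mem_ofPred_eq, P.F_quantile hr, mem_Ioo, hr.2, and_true, h]
  calc ∫⁻ r in Ioo q 1, ENNReal.ofReal (P.h r)
      = ∫⁻ r in Ioo 0 1, Φ (P.quantile r) := by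
        rw [← setLIntegral_congr_fun measurableSet_Ioo hquantile, lintegral_indicator
          measurableSet_Ioo, Measure.restrict_restrict measurableSet_Ioo,
          inter_eq_left.2 (Ioo_subset_Ioo_left hq)]
    _ = ∫⁻ z, Φ z ∂P.law := by
        rw [← map_quantile, lintegral_map' (hϑ.indicator hS).aemeasurable P.aemeasurable_quantile]
    _ = ∫⁻ z in {z | q < P.F z}, ENNReal.ofReal (P.f z * P.virtualValue z) := by
        rw [hΦ, lintegral_indicator hS, law, setLIntegral_withDensity_eq_setLIntegral_mul _
          P.measurable_f.ennreal_ofReal hϑ hS]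
        simp only [Pi.mul_apply, ENNReal.ofReal_mul (P.f_nonneg _)]

theorem lintegral_h_le {b q : ℝ} (hb : P.F b = 1) (hq : 0 ≤ q) :
    ∫⁻ r in Ioo q 1, ENNReal.ofReal (P.h r) ≤ ENNReal.ofReal (b * (1 - q)) := by
  have hb0 : 0 ≤ b := P.nonneg_of_F_pos (hb ▸ one_pos)
  have hS : MeasurableSet {z | q < P.F z} := measurableSet_lt measurable_const P.F_mono.measurable
  have hle : ∀ z ∈ {z | q < P.F z}, ENNReal.ofReal (P.f z * P.virtualValue z) ≤
      (Icc 0 b).indicator (fun _ => ENNReal.ofReal (1 - q)) z := by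
    intro z (hqz : q < P.F z)
    rcases (P.f_nonneg z).eq_or_lt with hf | hf
    · rw [← hf, zero_mul, ENNReal.ofReal_zero]
      exact zero_le
    rw [virtualValue, mul_div_cancel₀ _ hf.ne']
    rcases le_or_gt z b with hzb | hzb
    · rw [indicator_of_mem (mem_Icc.2 ⟨P.support_nonneg z hf, hzb⟩)]
      gcongr
    · rw [ENNReal.ofReal_of_nonpos (sub_nonpos.2 (hb.ge.trans (P.F_mono hzb.le)))]
      exact zero_le
  calc ∫⁻ r in Ioo q 1, ENNReal.ofReal (P.h r)
      ≤ ∫⁻ z in {z | q < P.F z}, (Icc 0 b).indicator (fun _ => ENNReal.ofReal (1 - q)) z :=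
        (P.lintegral_h_eq hq).trans_le (setLIntegral_mono' hS hle)
    _ ≤ ∫⁻ z, (Icc 0 b).indicator (fun _ => ENNReal.ofReal (1 - q)) z :=
        setLIntegral_le_lintegral _ _
    _ = ENNReal.ofReal (b * (1 - q)) := by
        rw [lintegral_indicator_const measurableSet_Icc, Real.volume_Icc, sub_zero,
          ENNReal.ofReal_mul hb0, mul_comm]

theorem integrableOn_h {b : ℝ} (hb : P.F b = 1) : IntegrableOn P.h (Ioo 0 1) := by
  refine ⟨P.aemeasurable_h.aestronglyMeasurable, ?_⟩
  rw [hasFiniteIntegral_iff_ofReal (ae_of_all _ P.h_nonneg)]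
  exact (P.lintegral_h_le hb le_rfl).trans_lt ENNReal.ofReal_lt_top

theorem H_nonneg {q : ℝ} (hq : 0 ≤ q) : 0 ≤ P.H q :=
  intervalIntegral.integral_nonneg hq fun _ _ => P.h_nonneg _

theorem H_one_sub_H {b q : ℝ} (hb : P.F b = 1) (hq : 0 ≤ q) (hq1 : q ≤ 1) :
    P.H 1 - P.H q = ∫ r in q..1, P.h r := by
  have hint {r : ℝ} (hr : 0 ≤ r) (hr1 : r ≤ 1) : IntervalIntegrable P.h volume 0 r := by
    rw [intervalIntegrable_iff_integrableOn_Ioo_of_le hr]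
    exact (P.integrableOn_h hb).mono_set (Ioo_subset_Ioo_right hr1)
  exact intervalIntegral.integral_interval_sub_left (hint zero_le_one le_rfl) (hint hq hq1)

theorem H_le_H_one {b q : ℝ} (hb : P.F b = 1) (hq : 0 ≤ q) (hq1 : q ≤ 1) : P.H q ≤ P.H 1 :=
  sub_nonneg.1 <| (P.H_one_sub_H hb hq hq1).symm ▸
    intervalIntegral.integral_nonneg hq1 fun _ _ => P.h_nonneg _

theorem H_one_sub_H_le {b q : ℝ} (hb : P.F b = 1) (hq : 0 ≤ q) (hq1 : q ≤ 1) :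
    P.H 1 - P.H q ≤ b * (1 - q) := by
  have hmeas : AEStronglyMeasurable P.h (volume.restrict (Ioo q 1)) :=
    ((P.integrableOn_h hb).mono_set (Ioo_subset_Ioo_left hq)).aestronglyMeasurable
  rw [P.H_one_sub_H hb hq hq1, intervalIntegral.integral_of_le hq1, integral_Ioc_eq_integral_Ioo,
    integral_eq_lintegral_of_nonneg_ae (ae_of_all _ P.h_nonneg) hmeas]
  exact ENNReal.toReal_le_of_le_ofReal
    (mul_nonneg (P.nonneg_of_F_pos (hb ▸ one_pos)) (sub_nonneg.2 hq1)) (P.lintegral_h_le hb hq)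

theorem le_G {φ : ℝ → ℝ} (hφ : ConvexOn ℝ (Ico 0 1) φ) (hle : ∀ r ∈ Ico (0 : ℝ) 1, φ r ≤ P.H r)
    {q : ℝ} (hq : q ∈ Ico (0 : ℝ) 1) : φ q ≤ P.G q := by
  refine le_csSup ⟨P.H q, ?_⟩ ⟨φ, hφ, hle, rfl⟩
  rintro _ ⟨ψ, -, hψ, rfl⟩
  exact hψ q hq

theorem G_le {q y : ℝ} (h : ∀ φ : ℝ → ℝ, ConvexOn ℝ (Ico 0 1) φ →
    (∀ r ∈ Ico (0 : ℝ) 1, φ r ≤ P.H r) → φ q ≤ y) : P.G q ≤ y := by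
  refine csSup_le ⟨0, fun _ => 0, convexOn_const 0 (convex_Ico 0 1), fun _ hr => P.H_nonneg hr.1,
    rfl⟩ ?_
  rintro _ ⟨ψ, hψ, hle, rfl⟩
  exact h ψ hψ hle

theorem G_nonneg {q : ℝ} (hq : q ∈ Ico (0 : ℝ) 1) : 0 ≤ P.G q :=
  P.le_G (convexOn_const 0 (convex_Ico 0 1)) (fun _ hr => P.H_nonneg hr.1) hq

theorem G_le_H {q : ℝ} (hq : q ∈ Ico (0 : ℝ) 1) : P.G q ≤ P.H q :=
  P.G_le fun _ _ h => h q hq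

theorem G_zero : P.G 0 = 0 :=
  have h0 : (0 : ℝ) ∈ Ico (0 : ℝ) 1 := ⟨le_rfl, one_pos⟩
  ((P.G_le_H h0).trans_eq intervalIntegral.integral_same).antisymm (P.G_nonneg h0)

theorem convexOn_G : ConvexOn ℝ (Ico 0 1) P.G := by
  refine ⟨convex_Ico 0 1, fun x hx y hy a b ha hb hab => P.G_le fun φ hφ hle => ?_⟩
  refine (hφ.2 hx hy ha hb hab).trans ?_
  gcongr
  · exact P.le_G hφ hle hx
  · exact P.le_G hφ hle hy

theorem slope_G_nonneg {q r : ℝ} (hq : 0 ≤ q) (hqr : q < r) (hr : r < 1) : 0 ≤ slope P.G q r := by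
  have hr0 : 0 < r := hq.trans_lt hqr
  rw [slope_comm]
  calc 0 ≤ slope P.G r 0 := by
        rw [slope_comm, slope_def_field, P.G_zero, sub_zero, sub_zero]
        exact div_nonneg (P.G_nonneg ⟨hr0.le, hr⟩) hr0.le
    _ ≤ slope P.G r q := P.convexOn_G.slope_mono ⟨hr0.le, hr⟩ ⟨⟨le_rfl, one_pos⟩, hr0.ne⟩
        ⟨⟨hq, hqr.trans hr⟩, hqr.ne⟩ hq

theorem hasDerivWithinAt_G {q : ℝ} (hq : q ∈ Ico (0 : ℝ) 1) :
    HasDerivWithinAt P.G (P.g q) (Ici q) q := by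
  have hbdd : BddBelow (slope P.G q '' Ioo q 1) := by
    refine ⟨0, ?_⟩
    rintro _ ⟨r, hr, rfl⟩
    exact P.slope_G_nonneg hq.1 hr.1 hr.2
  rw [g, if_pos hq.2]
  exact (hasDerivWithinAt_Ici_sInf_slope P.convexOn_G hq hq.2
    (fun r hr => ⟨hq.1.trans hr.1.le, hr.2⟩) hbdd).differentiableWithinAt.hasDerivWithinAt

theorem g_le_slope {q r : ℝ} (hq : 0 ≤ q) (hqr : q < r) (hr : r < 1) : P.g q ≤ slope P.G q r :=
  P.convexOn_G.le_slope_of_hasDerivWithinAt_Ioi ⟨hq, hqr.trans hr⟩ ⟨hq.trans hqr.le, hr⟩ hqr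
    (P.hasDerivWithinAt_G ⟨hq, hqr.trans hr⟩).Ioi_of_Ici

theorem le_g {q y : ℝ} (hq : q ∈ Ico (0 : ℝ) 1) (h : ∀ r, q < r → r < 1 → y ≤ slope P.G q r) :
    y ≤ P.g q := by
  refine ge_of_tendsto ((hasDerivWithinAt_iff_tendsto_slope' self_notMem_Ioi).1
    (P.hasDerivWithinAt_G hq).Ioi_of_Ici) ?_
  filter_upwards [Ioo_mem_nhdsGT hq.2] with r hr
  exact h r hr.1 hr.2

theorem monotoneOn_g : MonotoneOn P.g (Ico 0 1) := by
  intro q hq r hr hqr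
  rcases hqr.eq_or_lt with rfl | hqr
  · exact le_rfl
  refine P.le_g hr fun s hrs hs => (P.g_le_slope hq.1 hqr hr.2).trans ?_
  rw [slope_def_field, slope_def_field]
  exact P.convexOn_G.slope_mono_adjacent hq ⟨hr.1.trans hrs.le, hs⟩ hqr hrs

theorem g_one : P.g 1 = sSup (P.g '' Ico 0 1) := by
  rw [g, if_neg (lt_irrefl _)]
  congr 1
  exact image_congr fun r hr => (if_pos hr.2).symm

theorem line_le_G {b q : ℝ} (hb : P.F b = 1) (hq : q ∈ Ico (0 : ℝ) 1) :
    P.H 1 - b * (1 - q) ≤ P.G q := by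
  refine P.le_G (φ := fun r => P.H 1 - b * (1 - r)) ⟨convex_Ico 0 1, ?_⟩ (fun r hr => ?_) hq
  · intro x _ y _ s t _ _ hst
    simp only [smul_eq_mul]
    linear_combination (b - P.H 1) * hst
  · linarith [P.H_one_sub_H_le hb hr.1 hr.2.le]

/-- The supremum `g 1` of an unbounded function would be the junk value `0`. If `F` never attains
`1`, then `g` may be unbounded, but `g 1` is not used. -/
theorem bddAbove_g {b : ℝ} (hb : P.F b = 1) : BddAbove (P.g '' Ico 0 1) := by
  refine ⟨2 * b, ?_⟩
  rintro _ ⟨q, hq, rfl⟩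
  obtain ⟨hqr, hr1⟩ : q < (q + 1) / 2 ∧ (q + 1) / 2 < 1 := by
    constructor <;> linarith [hq.2]
  have hr0 : 0 ≤ (q + 1) / 2 := hq.1.trans hqr.le
  have hG : P.G ((q + 1) / 2) ≤ P.H 1 := (P.G_le_H ⟨hr0, hr1⟩).trans (P.H_le_H_one hb hr0 hr1.le)
  refine (P.g_le_slope hq.1 hqr hr1).trans ?_
  rw [slope_def_field, div_le_iff₀ (by linarith)]
  linarith [P.line_le_G hb hq]

theorem monotone_ironed : Monotone P.ironed := by
  intro y z hyz
  have hF := P.F_mono hyz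
  rw [ironed, ironed]
  rcases (P.F_le_one y).eq_or_lt with hy | hy
  · rw [hy, (P.F_le_one z).antisymm (hy ▸ hF)]
  rcases (P.F_le_one z).eq_or_lt with hz | hz
  · rw [hz, g_one]
    exact le_csSup (P.bddAbove_g hz) (mem_image_of_mem _ ⟨P.F_nonneg y, hy⟩)
  · exact P.monotoneOn_g ⟨P.F_nonneg y, hy⟩ ⟨P.F_nonneg z, hz⟩ hF

end Prior

open Finset

section RandomSet

variable {α : Type*} [DecidableEq α] {𝒜 : Finset (Finset α)}

theorem expect_mem_nonneg (i : α) : 0 ≤ 𝔼 A ∈ 𝒜, if i ∈ A then (1 : ℝ) else 0 :=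
  expect_nonneg fun _ _ => ite_nonneg zero_le_one le_rfl

theorem expect_mem_le_one (i : α) : (𝔼 A ∈ 𝒜, if i ∈ A then (1 : ℝ) else 0) ≤ 1 := by
  rcases 𝒜.eq_empty_or_nonempty with rfl | h𝒜
  · rw [expect_empty]
    exact zero_le_one
  · exact expect_le h𝒜 fun A _ => by split_ifs <;> norm_num

theorem expect_sum_eq_sum_expect_mem {B : Finset α} (h : ∀ A ∈ 𝒜, A ⊆ B) (w : α → ℝ) :
    𝔼 A ∈ 𝒜, ∑ i ∈ A, w i = ∑ i ∈ B, (𝔼 A ∈ 𝒜, if i ∈ A then (1 : ℝ) else 0) * w i := by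
  simp only [expect_mul, ← expect_sum_comm, ite_mul, one_mul, zero_mul]
  refine expect_congr rfl fun A hA => ?_
  rw [← sum_filter, filter_mem_eq_inter, inter_eq_right.2 (h A hA)]

theorem expect_mem_le_expect_mem {i j : α}
    (h : ∀ A ∈ 𝒜, i ∈ A → j ∉ A → insert j (A.erase i) ∈ 𝒜) :
    (𝔼 A ∈ 𝒜, if i ∈ A then (1 : ℝ) else 0) ≤ 𝔼 A ∈ 𝒜, if j ∈ A then (1 : ℝ) else 0 := by
  have hcard : #{A ∈ 𝒜 | i ∈ A} ≤ #{A ∈ 𝒜 | j ∈ A} := by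
    refine card_le_card_of_injOn (fun A => if j ∈ A then A else insert j (A.erase i)) ?_ ?_
    · intro A hA
      grind
    · intro A hA B hB hAB
      ext x
      have := congrArg (x ∈ ·) hAB
      have := congrArg (i ∈ ·) hAB
      grind
  simp only [expect_eq_sum_div_card, sum_boole]
  gcongr

theorem expect_mem_powersetCard {B : Finset α} {m : ℕ} (hm : m ≤ #B) {i : α} (hi : i ∈ B) :
    (𝔼 W ∈ B.powersetCard m, if i ∈ W then (1 : ℝ) else 0) = m / #B := by
  have hsymm : ∀ j ∈ B, (𝔼 W ∈ B.powersetCard m, if j ∈ W then (1 : ℝ) else 0) =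
      𝔼 W ∈ B.powersetCard m, if i ∈ W then (1 : ℝ) else 0 := by
    have hswap {a b : α} (hb : b ∈ B) : ∀ W ∈ B.powersetCard m, a ∈ W → b ∉ W →
        insert b (W.erase a) ∈ B.powersetCard m := by
      intro W hW ha hbW
      obtain ⟨hWB, hWm⟩ := mem_powersetCard.1 hW
      refine mem_powersetCard.2
        ⟨insert_subset hb ((erase_subset _ _).trans hWB), ?_⟩
      rw [card_insert_of_notMem (fun hmem => hbW (mem_of_mem_erase hmem)),
        card_erase_add_one ha, hWm]
    exact fun j hj =>
      (expect_mem_le_expect_mem (hswap hi)).antisymm (expect_mem_le_expect_mem (hswap hj))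
  have hsum : ∑ j ∈ B, (𝔼 W ∈ B.powersetCard m, if j ∈ W then (1 : ℝ) else 0) = m := by
    have h1 := expect_sum_eq_sum_expect_mem (fun W hW => (mem_powersetCard.1 hW).1)
      (𝒜 := B.powersetCard m) (B := B) fun _ => 1
    simp only [mul_one, sum_const, nsmul_eq_mul] at h1
    rw [← h1]
    exact (expect_congr rfl fun W hW => by rw [(mem_powersetCard.1 hW).2]).trans
      (expect_const (powersetCard_nonempty.2 hm) _)
  have hB : (#B : ℝ) ≠ 0 := Nat.cast_ne_zero.2 (card_ne_zero_of_mem hi)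
  rw [eq_div_iff hB, mul_comm, ← nsmul_eq_mul, ← sum_const, ← sum_congr rfl hsymm, hsum]

end RandomSet

section WinProb

/-- The probability that each of `b` buyers is served when `k` units are rationed uniformly at
random. Writing it as `k / max k b` keeps it antitone in `b`, with the value `1` at `b = 0`. -/
def winProb (k b : ℕ) : ℝ := k / (max k b : ℕ)

theorem winProb_nonneg (k b : ℕ) : 0 ≤ winProb k b := by
  unfold winProb
  positivity

theorem winProb_le_one (k b : ℕ) : winProb k b ≤ 1 :=
  div_le_one_of_le₀ (Nat.cast_le.2 (le_max_left k b)) (Nat.cast_nonneg _)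

theorem winProb_eq_one {k b : ℕ} (hk : 1 ≤ k) (hb : b ≤ k) : winProb k b = 1 := by
  rw [winProb, max_eq_left hb, div_self (Nat.cast_ne_zero.2 (by omega))]

theorem winProb_eq_min_div {k b : ℕ} (hb : b ≠ 0) : winProb k b = (min k b : ℕ) / (b : ℝ) := by
  have hb' : (b : ℝ) ≠ 0 := Nat.cast_ne_zero.2 hb
  rcases le_total k b with h | h
  · rw [winProb, max_eq_right h, min_eq_left h]
  · rw [winProb_eq_one (by omega) h, min_eq_right h, div_self hb']

theorem winProb_le_mul {k m b b' : ℕ} (hm : 1 ≤ m) (h : b' ≤ m * b) :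
    winProb k b ≤ m * winProb k b' := by
  rcases k.eq_zero_or_pos with rfl | hk
  · simp only [winProb, Nat.cast_zero, zero_div, mul_zero, le_refl]
  have hmax : max k b' ≤ m * max k b :=
    max_le ((le_max_left k b).trans (Nat.le_mul_of_pos_left _ hm))
      (h.trans (Nat.mul_le_mul_left m (le_max_right k b)))
  have hpos (c : ℕ) : (0 : ℝ) < (max k c : ℕ) := Nat.cast_pos.2 (lt_max_of_lt_left hk)
  rw [winProb, winProb, mul_div_assoc', div_le_div_iff₀ (hpos b) (hpos b'), mul_comm (m : ℝ),
    mul_assoc]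
  gcongr
  exact_mod_cast hmax

theorem winProb_antitone (k : ℕ) : Antitone (winProb k) := fun b b' h => by
  simpa only [Nat.cast_one, one_mul] using winProb_le_mul le_rfl (h.trans_eq (one_mul b').symm)

end WinProb

section Lottery

variable {n k : ℕ} {v : Fin n → ℝ} {T U : Finset (Fin n)} {p : ℝ}

/-- The total surplus that the agents of `T` would obtain if all of them could buy at price `p`. -/
def excess (v : Fin n → ℝ) (T : Finset (Fin n)) (p : ℝ) : ℝ := ∑ i ∈ T, max (v i - p) 0

theorem excess_nonneg (v : Fin n → ℝ) (T : Finset (Fin n)) (p : ℝ) : 0 ≤ excess v T p :=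
  sum_nonneg fun _ _ => le_max_right _ _

theorem sum_buyers_sub (v : Fin n → ℝ) (T : Finset (Fin n)) (p : ℝ) :
    ∑ i ∈ buyers v T p, (v i - p) = excess v T p := by
  rw [excess, buyers, sum_filter]
  refine sum_congr rfl fun i _ => ?_
  split_ifs with h
  · rw [max_eq_left (sub_nonneg.2 h.le)]
  · rw [max_eq_right (sub_nonpos.2 (not_lt.1 h))]

theorem buyers_subset_buyers (h : T ⊆ U) : buyers v T p ⊆ buyers v U p := filter_subset_filter _ h

theorem lottery_eq (k : ℕ) (v : Fin n → ℝ) (T : Finset (Fin n)) (p : ℝ) :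
    lottery k v T p = winProb k #(buyers v T p) * excess v T p := by
  rw [lottery, expect_sum_eq_sum_expect_mem fun W hW => (mem_powersetCard.1 hW).1,
    ← sum_buyers_sub, mul_sum]
  refine sum_congr rfl fun i hi => ?_
  rw [expect_mem_powersetCard (min_le_right _ _) hi, winProb_eq_min_div (card_ne_zero_of_mem hi)]

theorem lottery_nonneg (k : ℕ) (v : Fin n → ℝ) (T : Finset (Fin n)) (p : ℝ) :
    0 ≤ lottery k v T p := by
  rw [lottery_eq]
  exact mul_nonneg (winProb_nonneg _ _) (excess_nonneg _ _ _)

theorem excess_le_lottery (hk : 1 ≤ k) (h : #(buyers v T p) ≤ k) :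
    excess v T p ≤ lottery k v T p := by
  rw [lottery_eq, winProb_eq_one hk h, one_mul]

end Lottery

section Allocation

variable {n k : ℕ} {θ : ℝ → ℝ} {v : Fin n → ℝ} {i j : Fin n} {A : Finset (Fin n)}

theorem mem_optAllocations : A ∈ optAllocations k θ v ↔
    #A ≤ k ∧ ∀ B : Finset (Fin n), #B ≤ k → ∑ i ∈ B, θ (v i) ≤ ∑ i ∈ A, θ (v i) := by
  simp only [optAllocations, mem_filter_univ]

theorem optAllocations_nonempty (k : ℕ) (θ : ℝ → ℝ) (v : Fin n → ℝ) :
    (optAllocations k θ v).Nonempty := by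
  obtain ⟨A, hA, hmax⟩ := exists_max_image {A : Finset (Fin n) | #A ≤ k}
    (fun A => ∑ i ∈ A, θ (v i)) ⟨∅, by simp⟩
  simp only [mem_filter_univ] at hA hmax
  exact ⟨A, mem_optAllocations.2 ⟨hA, hmax⟩⟩

theorem card_insert_erase (hi : i ∈ A) (hj : j ∉ A) : #(insert j (A.erase i)) = #A := by
  rw [card_insert_of_notMem fun h => hj (mem_of_mem_erase h), card_erase_add_one hi]

theorem sum_insert_erase (hi : i ∈ A) (hj : j ∉ A) (w : Fin n → ℝ) :
    ∑ l ∈ insert j (A.erase i), w l = w j - w i + ∑ l ∈ A, w l := by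
  rw [sum_insert fun h => hj (mem_of_mem_erase h), ← add_sum_erase A w hi]
  ring

theorem le_of_mem_optAllocations (hA : A ∈ optAllocations k θ v) (hi : i ∈ A) (hj : j ∉ A) :
    θ (v j) ≤ θ (v i) := by
  obtain ⟨hcard, hmax⟩ := mem_optAllocations.1 hA
  have := hmax (insert j (A.erase i)) ((card_insert_erase hi hj).trans_le hcard)
  rw [sum_insert_erase hi hj fun l => θ (v l)] at this
  linarith

theorem insert_erase_mem_optAllocations (hij : θ (v i) ≤ θ (v j)) (hA : A ∈ optAllocations k θ v)
    (hi : i ∈ A) (hj : j ∉ A) : insert j (A.erase i) ∈ optAllocations k θ v := by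
  obtain ⟨hcard, hmax⟩ := mem_optAllocations.1 hA
  refine mem_optAllocations.2
    ⟨(card_insert_erase hi hj).trans_le hcard, fun B hB => (hmax B hB).trans ?_⟩
  rw [sum_insert_erase hi hj fun l => θ (v l)]
  linarith

theorem allocProb_nonneg (k : ℕ) (θ : ℝ → ℝ) (v : Fin n → ℝ) (i : Fin n) :
    0 ≤ allocProb k θ v i :=
  expect_mem_nonneg i

theorem allocProb_le_one (k : ℕ) (θ : ℝ → ℝ) (v : Fin n → ℝ) (i : Fin n) :
    allocProb k θ v i ≤ 1 :=
  expect_mem_le_one i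

theorem allocProb_le_allocProb (k : ℕ) (hij : θ (v i) ≤ θ (v j)) :
    allocProb k θ v i ≤ allocProb k θ v j :=
  expect_mem_le_expect_mem fun _ => insert_erase_mem_optAllocations hij

theorem sum_allocProb_le (k : ℕ) (θ : ℝ → ℝ) (v : Fin n → ℝ) :
    ∑ i, allocProb k θ v i ≤ k := by
  have h := expect_sum_eq_sum_expect_mem (𝒜 := optAllocations k θ v) (fun A _ => subset_univ A)
    fun _ => 1
  simp only [mul_one, sum_const, nsmul_eq_mul] at h
  exact h.symm.trans_le (expect_le (optAllocations_nonempty k θ v) fun A hA =>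
    Nat.cast_le.2 (mem_optAllocations.1 hA).1)

theorem allocProb_le_winProb (k : ℕ) (θ : ℝ → ℝ) (v : Fin n → ℝ) (i : Fin n) :
    allocProb k θ v i ≤ winProb k #{j | θ (v i) ≤ θ (v j)} := by
  have hi : i ∈ ({j | θ (v i) ≤ θ (v j)} : Finset (Fin n)) := mem_filter_univ _ |>.2 le_rfl
  set L : Finset (Fin n) := {j | θ (v i) ≤ θ (v j)}
  rcases le_total #L k with h | h
  · rw [winProb_eq_one ((card_pos.2 ⟨i, hi⟩).trans_le h) h]
    exact allocProb_le_one k θ v i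
  · have hpos : (0 : ℝ) < #L := Nat.cast_pos.2 (card_pos.2 ⟨i, hi⟩)
    rw [winProb, max_eq_right h, le_div_iff₀' hpos, ← nsmul_eq_mul, ← sum_const]
    calc ∑ _j ∈ L, allocProb k θ v i
        ≤ ∑ j ∈ L, allocProb k θ v j := sum_le_sum fun j hj =>
          allocProb_le_allocProb k ((mem_filter_univ j).1 hj)
      _ ≤ ∑ j, allocProb k θ v j :=
          sum_le_univ_sum_of_nonneg (allocProb_nonneg k θ v)
      _ ≤ k := sum_allocProb_le k θ v

theorem allocProb_eq_zero (h : k ≤ #{j | θ (v i) < θ (v j)}) : allocProb k θ v i = 0 := by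
  refine expect_eq_zero fun A hA => if_neg fun hi => ?_
  have hsub : ({j | θ (v i) < θ (v j)} : Finset (Fin n)) ⊂ A := by
    refine (ssubset_iff_of_subset fun j hj => ?_).2 ⟨i, hi, by simp⟩
    by_contra hjA
    exact ((mem_filter_univ j).1 hj).not_ge (le_of_mem_optAllocations hA hi hjA)
  exact (card_lt_card hsub).not_ge ((mem_optAllocations.1 hA).1.trans h)

/-- The expected residual surplus, on the profile `v`, of the mechanism that maximizes the virtual
surplus for the virtual valuation function `θ`, with ties broken uniformly at random; `mye k P` is
the case `θ = P.ironed`. -/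
def residualSurplus (k : ℕ) (θ : ℝ → ℝ) (v : Fin n → ℝ) : ℝ :=
  𝔼 A ∈ optAllocations k θ v, ∑ i ∈ A, (v i - payment k θ v i / allocProb k θ v i)

/-- An inequality, because the utility of an agent `i` who never wins is `0`. -/
theorem residualSurplus_le (k : ℕ) (θ : ℝ → ℝ) (hv : ∀ i, 0 ≤ v i) :
    residualSurplus k θ v ≤
      ∑ i, ∫ t in (0 : ℝ)..v i, allocProb k θ (Function.update v i t) i := by
  rw [residualSurplus, expect_sum_eq_sum_expect_mem fun A _ => subset_univ A]
  refine sum_le_sum fun i _ => ?_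
  change allocProb k θ v i * _ ≤ _
  rcases (allocProb_nonneg k θ v i).eq_or_lt with hx | hx
  · rw [← hx, zero_mul]
    exact intervalIntegral.integral_nonneg (hv i) fun t _ => allocProb_nonneg _ _ _ _
  · rw [mul_sub, mul_div_cancel₀ _ hx.ne', payment, mul_comm, sub_sub_cancel]

end Allocation

section TwoLotteries

open MeasureTheory

theorem integral_le_of_le_indicator {x : ℝ → ℝ} {c p q u : ℝ} (hu : 0 ≤ u) (hx : ∀ t, 0 ≤ x t)
    (hle : ∀ t ∈ Set.Ioc 0 u,
      x t ≤ c * (Set.Icc q u).indicator 1 t + (Set.Icc p u).indicator 1 t) (hc : 0 ≤ c) :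
    ∫ t in (0 : ℝ)..u, x t ≤ c * max (u - q) 0 + max (u - p) 0 := by
  have hint (a : ℝ) : Integrable ((Set.Icc a u).indicator (1 : ℝ → ℝ)) :=
    (integrable_indicator_iff measurableSet_Icc).2 (integrableOn_const (by simp))
  have hind (a t : ℝ) : 0 ≤ (Set.Icc a u).indicator (1 : ℝ → ℝ) t :=
    Set.indicator_nonneg (fun _ _ => zero_le_one) t
  calc ∫ t in (0 : ℝ)..u, x t
      = ∫ t, (Set.Ioc 0 u).indicator x t := by
        rw [intervalIntegral.integral_of_le hu, integral_indicator measurableSet_Ioc]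
    _ ≤ ∫ t, (c * (Set.Icc q u).indicator 1 t + (Set.Icc p u).indicator 1 t) := by
        refine integral_mono_of_nonneg (ae_of_all _ (Set.indicator_nonneg fun t _ => hx t))
          (((hint q).const_mul c).add (hint p)) (ae_of_all _ ?_)
        exact Set.indicator_le' hle fun t _ => add_nonneg (mul_nonneg hc (hind q t)) (hind p t)
    _ = c * max (u - q) 0 + max (u - p) 0 := by
        rw [integral_add ((hint q).const_mul c) (hint p), integral_const_mul,
          integral_indicator_one measurableSet_Icc, integral_indicator_one measurableSet_Icc,
          Real.volume_real_Icc, Real.volume_real_Icc]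

theorem exists_cutoff {ι : Type*} [Finite ι] (v : ι → ℝ) {D : Set ℝ} (hD : IsUpperSet D) :
    ∃ p, 0 ≤ p ∧ (∀ t, 0 ≤ t → t < p → t ∉ D) ∧ ∀ i, p < v i → v i ∈ D := by
  obtain ⟨p, hp, hmax⟩ := Set.exists_max_image (insert 0 (Set.range v \ D)) id
    ((Set.finite_range v).sdiff.insert 0) (Set.insert_nonempty _ _)
  refine ⟨p, hmax 0 (Set.mem_insert _ _), fun t ht htp htD => ?_, fun i hi => ?_⟩
  · rcases hp with rfl | hp
    · exact ht.not_gt htp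
    · exact hp.2 (hD htp.le htD)
  · by_contra hiD
    exact hi.not_ge (hmax _ (Set.mem_insert_of_mem _ ⟨Set.mem_range_self i, hiD⟩))

variable {n k : ℕ} {θ : ℝ → ℝ} {v : Fin n → ℝ} {i : Fin n} {t : ℝ}

theorem allocProb_update_le_winProb (k : ℕ) (hθ : Monotone θ) (ht : t ≤ v i) :
    allocProb k θ (Function.update v i t) i ≤ winProb k #{j | θ t ≤ θ (v j)} := by
  refine (allocProb_le_winProb _ _ _ _).trans_eq (congrArg (fun S => winProb k #S) ?_)
  ext j
  rcases eq_or_ne j i with rfl | hj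
  · simp [hθ ht]
  · simp [hj]

theorem allocProb_update_eq_zero (h : k < #{j | θ t < θ (v j)}) :
    allocProb k θ (Function.update v i t) i = 0 := by
  refine allocProb_eq_zero ((Nat.le_pred_of_lt h).trans (pred_card_le_card_erase (a := i) |>.trans
    (card_le_card fun j hj => ?_)))
  obtain ⟨hji, hj⟩ := mem_erase.1 hj
  simpa [hji] using hj

theorem isUpperSet_card_le_apply (k : ℕ) (hθ : Monotone θ) (v : Fin n → ℝ) :
    IsUpperSet {t | #{j | θ t ≤ θ (v j)} ≤ k} := fun _ _ hst hs =>
  (card_le_card (monotone_filter_right _ fun _ _ => (hθ hst).trans)).trans hs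

theorem isUpperSet_card_lt_apply (k : ℕ) (hθ : Monotone θ) (v : Fin n → ℝ) :
    IsUpperSet {t | #{j | θ t < θ (v j)} ≤ k} := fun _ _ hst hs =>
  (card_le_card (monotone_filter_right _ fun _ _ => (hθ hst).trans_lt)).trans hs

theorem card_buyers_le_of_forall_card_le_apply {p : ℝ} (hθ : Monotone θ)
    (hp : ∀ i, p < v i → #{j | θ (v i) ≤ θ (v j)} ≤ k) : #(buyers v univ p) ≤ k := by
  rcases (buyers v univ p).eq_empty_or_nonempty with h | h
  · rw [h, card_empty]
    exact k.zero_le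
  obtain ⟨l, hl, hmin⟩ := exists_min_image _ v h
  refine (card_le_card fun j hj => ?_).trans (hp l (mem_filter.1 hl).2)
  exact mem_filter_univ _ |>.2 (hθ (hmin j hj))

theorem card_buyers_le_card_le_apply {q : ℝ} (hq : ∀ i, q < v i → #{j | θ (v i) < θ (v j)} ≤ k)
    (ht : k < #{j | θ t ≤ θ (v j)}) : #(buyers v univ q) ≤ #{j | θ t ≤ θ (v j)} := by
  refine card_le_card fun l hl => mem_filter_univ _ |>.2 ?_
  by_contra! hlt
  exact ht.not_ge ((card_le_card (monotone_filter_right _ fun _ _ => hlt.trans_le)).trans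
    (hq l (mem_filter.1 hl).2))

/-- Below the price `p`, more than `k` agents have at least the virtual value of the bid; below `q`,
more than `k` agents have a larger one. A bid below `q` loses, one between `q` and `p` is rationed,
and only bids above `p` may win for sure. -/
theorem exists_integral_allocProb_le (k : ℕ) (hθ : Monotone θ) (v : Fin n → ℝ) :
    ∃ p q, 0 ≤ p ∧ 0 ≤ q ∧ #(buyers v univ p) ≤ k ∧ ∀ i, 0 ≤ v i →
      ∫ t in (0 : ℝ)..v i, allocProb k θ (Function.update v i t) i ≤
        winProb k #(buyers v univ q) * max (v i - q) 0 + max (v i - p) 0 := by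
  obtain ⟨p, hp, hlt_p, hp_lt⟩ := exists_cutoff v (isUpperSet_card_le_apply k hθ v)
  obtain ⟨q, hq, hlt_q, hq_lt⟩ := exists_cutoff v (isUpperSet_card_lt_apply k hθ v)
  refine ⟨p, q, hp, hq, card_buyers_le_of_forall_card_le_apply hθ hp_lt, fun i hi =>
    integral_le_of_le_indicator hi (fun t => allocProb_nonneg _ _ _ _) (fun t ht => ?_)
      (winProb_nonneg _ _)⟩
  have hnonneg : 0 ≤ winProb k #(buyers v univ q) * (Set.Icc q (v i)).indicator 1 t :=
    mul_nonneg (winProb_nonneg _ _) (Set.indicator_nonneg (fun _ _ => zero_le_one) _)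
  rcases lt_or_ge t q with htq | htq
  · rw [allocProb_update_eq_zero (not_le.1 (hlt_q t ht.1.le htq))]
    exact add_nonneg hnonneg (Set.indicator_nonneg (fun _ _ => zero_le_one) _)
  rcases lt_or_ge t p with htp | htp
  · rw [Set.indicator_of_mem (Set.mem_Icc.2 ⟨htq, ht.2⟩), Set.indicator_of_notMem
      fun h => htp.not_ge h.1, Pi.one_apply, mul_one, add_zero]
    exact (allocProb_update_le_winProb k hθ ht.2).trans
      (winProb_antitone k (card_buyers_le_card_le_apply hq_lt
        (not_le.1 (hlt_p t ht.1.le htp))))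
  · rw [Set.indicator_of_mem (Set.mem_Icc.2 ⟨htp, ht.2⟩), Pi.one_apply]
    exact (allocProb_le_one _ _ _ _).trans (le_add_of_nonneg_left hnonneg)

theorem exists_residualSurplus_le_lottery_add_lottery (hk : 1 ≤ k) (hθ : Monotone θ)
    (hv : ∀ i, 0 ≤ v i) : ∃ p q, 0 ≤ p ∧ 0 ≤ q ∧
      residualSurplus k θ v ≤ lottery k v univ p + lottery k v univ q := by
  obtain ⟨p, q, hp, hq, hbuyers, hint⟩ := exists_integral_allocProb_le k hθ v
  refine ⟨p, q, hp, hq, ?_⟩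
  calc residualSurplus k θ v
      ≤ ∑ i, ∫ t in (0 : ℝ)..v i, allocProb k θ (Function.update v i t) i :=
        residualSurplus_le k θ hv
    _ ≤ ∑ i, (winProb k #(buyers v univ q) * max (v i - q) 0 + max (v i - p) 0) :=
        sum_le_sum fun i _ => hint i (hv i)
    _ = lottery k v univ q + excess v univ p := by
        rw [sum_add_distrib, ← mul_sum, lottery_eq k v univ q, excess, excess]
    _ ≤ lottery k v univ p + lottery k v univ q := by
        rw [add_comm]
        gcongr
        exact excess_le_lottery hk hbuyers

end TwoLotteries

section LayerCake

open MeasureTheory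

variable {n : ℕ} {v : Fin n → ℝ} {T U : Finset (Fin n)} {p r : ℝ} {c : ℕ}

theorem card_buyers_eq_sum_indicator (v : Fin n → ℝ) (T : Finset (Fin n)) (t : ℝ) :
    (#(buyers v T t) : ℝ) = ∑ i ∈ T, (Set.Iio (v i)).indicator 1 t := by
  simp only [buyers, card_filter, Nat.cast_sum, Nat.cast_ite, Nat.cast_one, Nat.cast_zero,
    Set.indicator_apply, Set.mem_Iio, Pi.one_apply]

theorem integrableOn_indicator_Iio (p a : ℝ) :
    IntegrableOn ((Set.Iio a).indicator (1 : ℝ → ℝ)) (Set.Ioi p) := by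
  rw [IntegrableOn, integrable_indicator_iff measurableSet_Iio, IntegrableOn,
    Measure.restrict_restrict measurableSet_Iio, Set.Iio_inter_Ioi]
  exact integrableOn_const (by simp)

theorem integrableOn_card_buyers (v : Fin n → ℝ) (T : Finset (Fin n)) (p : ℝ) :
    IntegrableOn (fun t => (#(buyers v T t) : ℝ)) (Set.Ioi p) := by
  simp only [card_buyers_eq_sum_indicator]
  exact integrable_finsetSum _ fun i _ => integrableOn_indicator_Iio p (v i)

theorem excess_eq_integral (v : Fin n → ℝ) (T : Finset (Fin n)) (p : ℝ) :
    excess v T p = ∫ t in Set.Ioi p, (#(buyers v T t) : ℝ) := by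
  simp only [card_buyers_eq_sum_indicator]
  rw [integral_finsetSum _ fun i _ => integrableOn_indicator_Iio p (v i), excess]
  refine sum_congr rfl fun i _ => ?_
  rw [integral_indicator_one measurableSet_Iio, measureReal_restrict_apply measurableSet_Iio,
    Set.Iio_inter_Ioi, Real.volume_real_Ioo]

theorem excess_le_mul_excess (h : ∀ t, p < t → #(buyers v U t) ≤ c * #(buyers v T t)) :
    excess v U p ≤ c * excess v T p := by
  rw [excess_eq_integral, excess_eq_integral, ← integral_const_mul]
  exact setIntegral_mono_on (integrableOn_card_buyers v U p)
    ((integrableOn_card_buyers v T p).const_mul _) measurableSet_Ioi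
    fun t ht => by exact_mod_cast h t ht

theorem card_buyers_min (v : Fin n → ℝ) (r : ℝ) (T : Finset (Fin n)) (t : ℝ) :
    #(buyers (fun j => min (v j) r) T t) = if t < r then #(buyers v T t) else 0 := by
  split_ifs with ht <;> simp [buyers, ht]

theorem excess_le_excess_min_add {i : Fin n} (hri : r ≤ v i) (hle : ∀ j, j ≠ i → v j ≤ r)
    (T : Finset (Fin n)) (p : ℝ) :
    excess v T p ≤ excess (fun j => min (v j) r) T p + (v i - r) := by
  have hsingle : ∑ j ∈ T, (if j = i then v i - r else 0) ≤ v i - r := by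
    rw [sum_ite_eq']
    split_ifs
    · exact le_rfl
    · exact sub_nonneg.2 hri
  refine le_trans ?_ (add_le_add_right hsingle _)
  rw [excess, excess, ← sum_add_distrib]
  refine sum_le_sum fun j _ => ?_
  split_ifs with hj
  · subst hj
    rw [min_eq_right hri]
    rcases le_total r p with h | h <;> grind
  · rw [min_eq_left (hle j hj), add_zero]

theorem excess_le_mul_excess_add {i : Fin n} (hri : r ≤ v i) (hle : ∀ j, j ≠ i → v j ≤ r)
    (h : ∀ t, p < t → t < r → #(buyers v U t) ≤ c * #(buyers v T t)) :
    excess v U p ≤ c * excess v T p + (v i - r) := by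
  have hmin : excess (fun j => min (v j) r) U p ≤ c * excess (fun j => min (v j) r) T p := by
    refine excess_le_mul_excess fun t ht => ?_
    rw [card_buyers_min, card_buyers_min]
    split_ifs with htr
    · exact h t ht htr
    · exact Nat.zero_le _
  have hmono : excess (fun j => min (v j) r) T p ≤ excess v T p :=
    sum_le_sum fun j _ => max_le_max_right 0 (sub_le_sub_right (min_le_left _ _) p)
  calc excess v U p ≤ excess (fun j => min (v j) r) U p + (v i - r) :=
        excess_le_excess_min_add hri hle U p
    _ ≤ c * excess v T p + (v i - r) := by
        gcongr
        exact hmin.trans (by gcongr)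

end LayerCake

section Vickrey

variable {n k : ℕ} {v : Fin n → ℝ} {T : Finset (Fin n)} {i : Fin n} {x r : ℝ}

theorem mem_sortedValues : x ∈ sortedValues v T ↔ ∃ j ∈ T, v j = x := by
  rw [sortedValues, Multiset.mem_sort, Multiset.mem_map]
  rfl

theorem getD_sortedValues_le (hv : ∀ i, 0 ≤ v i) (hx : x ∈ (sortedValues v T).take k) :
    (sortedValues v T).getD k 0 ≤ x := by
  have hsort : (sortedValues v T).Pairwise (· ≥ ·) := Multiset.pairwise_sort _ _
  rcases lt_or_ge k (sortedValues v T).length with hk | hk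
  · rw [List.getD_eq_getElem _ _ hk]
    obtain ⟨m, hm, rfl⟩ := List.mem_take_iff_getElem.1 hx
    exact List.pairwise_iff_getElem.1 hsort m k _ hk (lt_of_lt_of_le hm (min_le_left _ _))
  · rw [List.getD_eq_default _ _ hk]
    obtain ⟨j, -, rfl⟩ := mem_sortedValues.1 (List.mem_of_mem_take hx)
    exact hv j

theorem vickrey_terms_nonneg (hv : ∀ i, 0 ≤ v i) (k : ℕ) (T : Finset (Fin n)) :
    ∀ y ∈ ((sortedValues v T).take k).map fun x => x - (sortedValues v T).getD k 0, 0 ≤ y := by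
  intro y hy
  obtain ⟨x, hx, rfl⟩ := List.mem_map.1 hy
  exact sub_nonneg.2 (getD_sortedValues_le hv hx)

theorem vickrey_nonneg (hv : ∀ i, 0 ≤ v i) (k : ℕ) (T : Finset (Fin n)) : 0 ≤ vickrey k v T :=
  List.sum_nonneg (vickrey_terms_nonneg hv k T)

theorem sortedValues_eq_cons (hi : i ∈ T) (hle : ∀ j ∈ T, v j ≤ v i) :
    sortedValues v T = v i :: sortedValues v (T.erase i) := by
  rw [sortedValues, sortedValues, ← Multiset.sort_cons, ← Multiset.map_cons,
    ← insert_val_of_notMem (notMem_erase i T), insert_erase hi]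
  intro x hx
  obtain ⟨j, hj, rfl⟩ := Multiset.mem_map.1 hx
  exact hle j (mem_of_mem_erase hj)

theorem getD_sortedValues_le_of_forall_le (hr : 0 ≤ r) (hle : ∀ j ∈ T, v j ≤ r) (m : ℕ) :
    (sortedValues v T).getD m 0 ≤ r := by
  rcases lt_or_ge m (sortedValues v T).length with hm | hm
  · rw [List.getD_eq_getElem _ _ hm]
    obtain ⟨j, hj, hjm⟩ := mem_sortedValues.1 (List.getElem_mem hm)
    exact hjm ▸ hle j hj
  · rwa [List.getD_eq_default _ _ hm]

theorem sub_le_vickrey (hk : 1 ≤ k) (hv : ∀ i, 0 ≤ v i) (hi : i ∈ T) (hr : 0 ≤ r) (hri : r ≤ v i)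
    (hle : ∀ j, j ≠ i → v j ≤ r) : v i - r ≤ vickrey k v T := by
  obtain ⟨m, rfl⟩ := Nat.exists_eq_add_of_le' hk
  have hcons := sortedValues_eq_cons hi fun j _ => (eq_or_ne j i).elim (fun h => h ▸ le_rfl)
    fun h => (hle j h).trans hri
  have hprice : (sortedValues v T).getD (m + 1) 0 ≤ r := by
    rw [hcons, List.getD_cons_succ]
    exact getD_sortedValues_le_of_forall_le hr (fun j hj => hle j (ne_of_mem_erase hj)) m
  refine (sub_le_sub_left hprice (v i)).trans
    (List.single_le_sum (vickrey_terms_nonneg hv (m + 1) T) _ (List.mem_map_of_mem ?_))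
  rw [hcons, List.take_succ_cons]
  exact List.mem_cons_self

end Vickrey

section Balanced

variable {n k : ℕ} {v : Fin n → ℝ} {i : Fin n} {r p : ℝ} {S : Finset (Fin n)}

/-- A sample `S` on which the lotteries run on `S` and on `Sᶜ` are comparable with those run on all
agents: `S` contains the agent `i`, meant to be one of highest valuation, and a
constant fraction of the buyers at every price, and `Sᶜ` contains a constant fraction of the buyers
at every price below the second highest valuation `r`. -/
def IsBalanced (v : Fin n → ℝ) (i : Fin n) (r : ℝ) (S : Finset (Fin n)) : Prop :=
  i ∈ S ∧ (∀ t, 0 ≤ t → #(buyers v univ t) ≤ 16 * #(buyers v S t)) ∧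
    ∀ t, 0 ≤ t → t < r → #(buyers v univ t) ≤ 16 * #(buyers v Sᶜ t)

theorem IsBalanced.lottery_univ_le (hS : IsBalanced v i r S) (k : ℕ) (hp : 0 ≤ p) (hri : r ≤ v i)
    (hle : ∀ j, j ≠ i → v j ≤ r) :
    lottery k v univ p ≤ 16 * lottery k v Sᶜ p + (v i - r) := by
  have hexcess : excess v univ p ≤ (16 : ℕ) * excess v Sᶜ p + (v i - r) :=
    excess_le_mul_excess_add hri hle fun t ht => hS.2.2 t (hp.trans ht.le)
  rw [lottery_eq, lottery_eq]
  calc winProb k #(buyers v univ p) * excess v univ p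
      ≤ winProb k #(buyers v univ p) * (16 * excess v Sᶜ p + (v i - r)) :=
        mul_le_mul_of_nonneg_left hexcess (winProb_nonneg _ _)
    _ = 16 * (winProb k #(buyers v univ p) * excess v Sᶜ p) +
          winProb k #(buyers v univ p) * (v i - r) := by ring
    _ ≤ 16 * (winProb k #(buyers v Sᶜ p) * excess v Sᶜ p) + (v i - r) := by
        gcongr
        · exact excess_nonneg _ _ _
        · exact winProb_antitone k (card_le_card (buyers_subset_buyers (subset_univ _)))
        · exact mul_le_of_le_one_left (sub_nonneg.2 hri) (winProb_le_one _ _)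

theorem IsBalanced.lottery_compl_le (hS : IsBalanced v i r S) (k : ℕ) (hp : 0 ≤ p)
    (hle : ∀ j, j ≠ i → v j ≤ r) : lottery k v Sᶜ p ≤ 256 * lottery k v S p := by
  rcases (buyers v Sᶜ p).eq_empty_or_nonempty with hempty | ⟨j, hj⟩
  · rw [lottery_eq k v Sᶜ, ← sum_buyers_sub, hempty, sum_empty, mul_zero]
    exact mul_nonneg (by norm_num) (lottery_nonneg _ _ _ _)
  obtain ⟨hjS, hpj⟩ := mem_filter.1 hj
  have hpr : p < r := hpj.trans_le (hle j fun h => mem_compl.1 hjS (h ▸ hS.1))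
  have hcard : #(buyers v S p) ≤ 16 * #(buyers v Sᶜ p) :=
    (card_le_card (buyers_subset_buyers (subset_univ S))).trans (hS.2.2 p hp hpr)
  have hexcess : excess v Sᶜ p ≤ (16 : ℕ) * excess v S p :=
    excess_le_mul_excess fun t ht =>
      (card_le_card (buyers_subset_buyers (subset_univ _))).trans (hS.2.1 t (hp.trans ht.le))
  rw [lottery_eq, lottery_eq]
  calc winProb k #(buyers v Sᶜ p) * excess v Sᶜ p
      ≤ ((16 : ℕ) * winProb k #(buyers v S p)) * ((16 : ℕ) * excess v S p) :=
        mul_le_mul (winProb_le_mul (by norm_num) hcard) hexcess (excess_nonneg _ _ _)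
          (mul_nonneg (Nat.cast_nonneg _) (winProb_nonneg _ _))
    _ = 256 * (winProb k #(buyers v S p) * excess v S p) := by
        push_cast
        ring

theorem IsBalanced.lottery_le (hS : IsBalanced v i r S) (hk : 1 ≤ k) (hv : ∀ i, 0 ≤ v i)
    (hr : 0 ≤ r) (hri : r ≤ v i) (hle : ∀ j, j ≠ i → v j ≤ r) (hp : 0 ≤ p) {p₂ : ℝ}
    (hp₂ : IsOptimalPrice k v Sᶜ p₂) :
    lottery k v univ p ≤ 8192 * (1 / 2 * lottery k v S p₂ + 1 / 2 * vickrey k v S) := by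
  have hvickrey : 0 ≤ vickrey k v S := vickrey_nonneg hv k S
  calc lottery k v univ p ≤ 16 * lottery k v Sᶜ p + (v i - r) := hS.lottery_univ_le k hp hri hle
    _ ≤ 16 * lottery k v Sᶜ p₂ + vickrey k v S := by
        gcongr
        · exact hp₂.2 p hp
        · exact sub_le_vickrey hk hv hS.1 hr hri hle
    _ ≤ 16 * (256 * lottery k v S p₂) + vickrey k v S := by
        gcongr
        exact hS.lottery_compl_le k hp₂.1 hle
    _ ≤ 8192 * (1 / 2 * lottery k v S p₂ + 1 / 2 * vickrey k v S) := by linarith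

end Balanced

section Sampling

theorem sum_pow_card_le_of_isChain {α : Type*} {𝒰 : Finset (Finset α)}
    (h𝒰 : IsChain (· ⊆ ·) (𝒰 : Set (Finset α))) {m : ℕ} (hm : ∀ U ∈ 𝒰, m ≤ #U) {y : ℝ}
    (hy : 0 ≤ y) (hy1 : y < 1) : ∑ U ∈ 𝒰, y ^ #U ≤ y ^ m / (1 - y) := by
  have hinj : Set.InjOn card (𝒰 : Set (Finset α)) := fun U hU V hV hUV =>
    (h𝒰.total hU hV).elim (fun h => eq_of_subset_of_card_le h hUV.ge)
      fun h => (eq_of_subset_of_card_le h hUV.le).symm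
  have hsub : 𝒰.image card ⊆ Ico m (𝒰.sup card + 1) := image_subset_iff.2 fun U hU =>
    mem_Ico.2 ⟨hm U hU, Nat.lt_succ_of_le (le_sup hU)⟩
  calc ∑ U ∈ 𝒰, y ^ #U = ∑ l ∈ 𝒰.image card, y ^ l := (sum_image hinj).symm
    _ ≤ ∑ l ∈ Ico m (𝒰.sup card + 1), y ^ l :=
        sum_le_sum_of_subset_of_nonneg hsub fun _ _ _ => pow_nonneg hy _
    _ ≤ y ^ m / (1 - y) := geom_sum_Ico_le_of_lt_one hy hy1

variable {α : Type*} [Fintype α] [DecidableEq α]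

theorem sum_pow_card_inter (U : Finset α) (x : ℝ) :
    ∑ S : Finset α, x ^ #(S ∩ U) = 2 ^ Fintype.card α * ((1 + x) / 2) ^ #U := by
  calc ∑ S : Finset α, x ^ #(S ∩ U)
      = ∏ j, (1 + if j ∈ U then x else 1) := by
        rw [prod_one_add, powerset_univ]
        exact sum_congr rfl fun S _ => by rw [prod_ite_mem, prod_const]
    _ = ∏ j, 2 * (if j ∈ U then (1 + x) / 2 else 1) :=
        prod_congr rfl fun j _ => by split_ifs <;> ring
    _ = 2 ^ Fintype.card α * ((1 + x) / 2) ^ #U := by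
        rw [prod_mul_distrib, prod_const, card_univ, prod_ite_mem, univ_inter, prod_const]

/-- Chernoff's method: every counted `S` has `1 ≤ y ^ #U * x ^ #(S ∩ U)`. -/
theorem card_mul_card_inter_lt_le (U : Finset α) {m : ℕ} {x y : ℝ} (hx : 0 ≤ x) (hy : 1 ≤ y)
    (hxy : 1 ≤ y ^ m * x) :
    (#{S : Finset α | m * #(S ∩ U) < #U} : ℝ) ≤
      2 ^ Fintype.card α * (y * ((1 + x) / 2)) ^ #U := by
  have hone (S : Finset α) (hS : m * #(S ∩ U) < #U) : 1 ≤ y ^ #U * x ^ #(S ∩ U) :=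
    calc (1 : ℝ) ≤ (y ^ m * x) ^ #(S ∩ U) := one_le_pow₀ hxy
      _ = y ^ (m * #(S ∩ U)) * x ^ #(S ∩ U) := by rw [mul_pow, pow_mul]
      _ ≤ y ^ #U * x ^ #(S ∩ U) := by gcongr
  calc (#{S : Finset α | m * #(S ∩ U) < #U} : ℝ)
      = ∑ S : Finset α with m * #(S ∩ U) < #U, (1 : ℝ) := by rw [sum_const, nsmul_one]
    _ ≤ ∑ S : Finset α with m * #(S ∩ U) < #U, y ^ #U * x ^ #(S ∩ U) :=
        sum_le_sum fun S hS => hone S ((mem_filter_univ S).1 hS)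
    _ ≤ ∑ S : Finset α, y ^ #U * x ^ #(S ∩ U) :=
        sum_le_univ_sum_of_nonneg fun S =>
          mul_nonneg (pow_nonneg (zero_le_one.trans hy) _) (pow_nonneg hx _)
    _ = 2 ^ Fintype.card α * (y * ((1 + x) / 2)) ^ #U := by
        rw [← mul_sum, sum_pow_card_inter, mul_pow]
        ring

theorem card_exists_mul_card_inter_lt_le {𝒰 : Finset (Finset α)}
    (h𝒰 : IsChain (· ⊆ ·) (𝒰 : Set (Finset α))) (hcard : ∀ U ∈ 𝒰, 17 ≤ #U) :
    (#{S : Finset α | ∃ U ∈ 𝒰, 16 * #(S ∩ U) < #U} : ℝ) ≤ 2 ^ Fintype.card α / 40 := by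
  have hunion : ({S | ∃ U ∈ 𝒰, 16 * #(S ∩ U) < #U} : Finset (Finset α)) =
      𝒰.biUnion fun U => {S | 16 * #(S ∩ U) < #U} := by
    ext S
    simp only [mem_filter_univ, mem_biUnion]
  calc (#{S : Finset α | ∃ U ∈ 𝒰, 16 * #(S ∩ U) < #U} : ℝ)
      ≤ ∑ U ∈ 𝒰, (#{S : Finset α | 16 * #(S ∩ U) < #U} : ℝ) := by
        rw [hunion]
        exact_mod_cast card_biUnion_le
    _ ≤ ∑ U ∈ 𝒰, 2 ^ Fintype.card α * (15 / 14 * ((1 + 1 / 3) / 2)) ^ #U :=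
        sum_le_sum fun U _ => card_mul_card_inter_lt_le U (by norm_num) (by norm_num) (by norm_num)
    _ ≤ 2 ^ Fintype.card α * ((5 / 7) ^ 17 / (1 - 5 / 7)) := by
        rw [← mul_sum, show (15 / 14 * ((1 + 1 / 3) / 2) : ℝ) = 5 / 7 by norm_num]
        gcongr
        exact sum_pow_card_le_of_isChain h𝒰 hcard (by norm_num) (by norm_num)
    _ ≤ 2 ^ Fintype.card α / 40 := by
        rw [div_eq_mul_inv _ (40 : ℝ)]
        gcongr
        norm_num

theorem card_filter_compl (P : Finset α → Prop) [DecidablePred P] :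
    #{S : Finset α | P Sᶜ} = #{S : Finset α | P S} :=
  card_nbij' compl compl (by simp [Set.MapsTo]) (by simp [Set.MapsTo]) (fun S _ => compl_compl S)
    fun S _ => compl_compl S

theorem four_mul_card_mem_notMem {a b : α} (hab : a ≠ b) :
    4 * #{S : Finset α | a ∈ S ∧ b ∉ S} = 2 ^ Fintype.card α := by
  have hIcc : ({S | a ∈ S ∧ b ∉ S} : Finset (Finset α)) = Icc {a} {b}ᶜ := by
    ext S
    simp only [mem_filter_univ, mem_Icc, singleton_subset_iff,
      subset_compl_singleton]
  have hcard : 2 ≤ Fintype.card α := Fintype.one_lt_card_iff.2 ⟨a, b, hab⟩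
  rw [hIcc, card_Icc_finset (by simpa using hab.symm), card_compl, card_singleton, card_singleton,
    show (4 : ℕ) = 2 ^ 2 by norm_num, ← pow_add]
  congr 1
  omega

/-- Sets of at most `16` elements are balanced as soon as `a ∈ S` and `b ∉ S`; the others have
distinct sizes, and the probabilities that they are not balanced sum to less than `1 / 20`. -/
theorem two_pow_card_le_card_balanced {a b : α} (hab : a ≠ b) {𝒰 : Finset (Finset α)}
    (h𝒰 : IsChain (· ⊆ ·) (𝒰 : Set (Finset α))) (hmem : ∀ U ∈ 𝒰, a ∈ U ∧ b ∈ U) :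
    (2 : ℝ) ^ Fintype.card α ≤ 5 * #{S : Finset α | a ∈ S ∧
      ∀ U ∈ 𝒰, #U ≤ 16 * #(S ∩ U) ∧ #U ≤ 16 * #(Sᶜ ∩ U)} := by
  let 𝒱 : Finset (Finset α) := {U ∈ 𝒰 | 17 ≤ #U}
  let sparse : Finset (Finset α) := {S | ∃ U ∈ 𝒱, 16 * #(S ∩ U) < #U}
  let sparseCompl : Finset (Finset α) := {S | ∃ U ∈ 𝒱, 16 * #(Sᶜ ∩ U) < #U}
  let balanced : Finset (Finset α) :=
    {S | a ∈ S ∧ ∀ U ∈ 𝒰, #U ≤ 16 * #(S ∩ U) ∧ #U ≤ 16 * #(Sᶜ ∩ U)}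
  have hsparse : (#sparse : ℝ) ≤ 2 ^ Fintype.card α / 40 := card_exists_mul_card_inter_lt_le
    (h𝒰.mono (filter_subset _ _)) fun U hU => (mem_filter.1 hU).2
  have hsparseCompl : (#sparseCompl : ℝ) ≤ 2 ^ Fintype.card α / 40 := by
    rwa [card_filter_compl fun S => ∃ U ∈ 𝒱, 16 * #(S ∩ U) < #U]
  have hcover : ({S | a ∈ S ∧ b ∉ S} : Finset (Finset α)) ⊆
      balanced ∪ (sparse ∪ sparseCompl) := by
    intro S hS
    obtain ⟨ha, hb⟩ := (mem_filter_univ S).1 hS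
    by_contra hnot
    simp only [mem_union, mem_filter, mem_univ, true_and, balanced, sparse, sparseCompl, 𝒱] at hnot
    push Not at hnot
    obtain ⟨hbal, hS, hSc⟩ := hnot
    obtain ⟨U, hU, hlt⟩ := hbal ha
    have hpos : 0 < #(S ∩ U) := card_pos.2 ⟨a, mem_inter.2 ⟨ha, (hmem U hU).1⟩⟩
    have hpos' : 0 < #(Sᶜ ∩ U) := card_pos.2 ⟨b, mem_inter.2 ⟨mem_compl.2 hb, (hmem U hU).2⟩⟩
    rcases le_or_gt 17 #U with h17 | h17
    · exact (hlt (hS U ⟨hU, h17⟩)).not_ge (hSc U ⟨hU, h17⟩)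
    · have := hlt (by omega)
      omega
  have hcard := (card_le_card hcover).trans ((card_union_le _ _).trans
    (Nat.add_le_add_left (card_union_le _ _) _))
  have hsep := four_mul_card_mem_notMem hab
  rify at hcard hsep
  linarith

end Sampling

section RSOL

open Classical in
theorem two_pow_le_card_isBalanced {n : ℕ} {v : Fin n → ℝ} {i j : Fin n} (hij : i ≠ j)
    (hji : v j ≤ v i) (hle : ∀ l, l ≠ i → v l ≤ v j) :
    (2 : ℝ) ^ n ≤ 5 * #{S : Finset (Fin n) | IsBalanced v i (v j) S} := by
  let 𝒰 : Finset (Finset (Fin n)) := {U | ∃ t < v j, buyers v univ t = U}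
  have hchain : IsChain (· ⊆ ·) (𝒰 : Set (Finset (Fin n))) := by
    rintro U hU V hV -
    obtain ⟨s, -, rfl⟩ := mem_filter_univ U |>.1 hU
    obtain ⟨t, -, rfl⟩ := mem_filter_univ V |>.1 hV
    exact (le_total t s).imp (fun h => monotone_filter_right _ fun _ _ => h.trans_lt)
      fun h => monotone_filter_right _ fun _ _ => h.trans_lt
  have hmem (U) (hU : U ∈ 𝒰) : i ∈ U ∧ j ∈ U := by
    obtain ⟨t, ht, rfl⟩ := mem_filter_univ U |>.1 hU
    exact ⟨mem_filter_univ i |>.2 (ht.trans_le hji), mem_filter_univ j |>.2 ht⟩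
  have hbalanced (S) (hS : i ∈ S ∧ ∀ U ∈ 𝒰, #U ≤ 16 * #(S ∩ U) ∧ #U ≤ 16 * #(Sᶜ ∩ U)) :
      IsBalanced v i (v j) S := by
    have hbelow (t) (ht : t < v j) := hS.2 _ (mem_filter_univ (buyers v univ t) |>.2 ⟨t, ht, rfl⟩)
    simp only [buyers, inter_filter, inter_univ] at hbelow
    refine ⟨hS.1, fun t _ => ?_, fun t _ ht => (hbelow t ht).2⟩
    rcases lt_or_ge t (v j) with ht | ht
    · exact (hbelow t ht).1
    · refine (card_le_card fun l hl => ?_).trans (Nat.le_mul_of_pos_left _ (by norm_num))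
      have hl : t < v l := (mem_filter_univ l).1 hl
      have hli : l = i := of_not_not fun hli => (ht.trans_lt hl).not_ge (hle l hli)
      exact mem_filter.2 ⟨hli ▸ hS.1, hl⟩
  have hcount := two_pow_card_le_card_balanced hij hchain hmem
  rw [Fintype.card_fin] at hcount
  exact hcount.trans (by gcongr with S; exact hbalanced S)

theorem isBalanced_univ_zero {n : ℕ} (v : Fin n → ℝ) (i : Fin n) : IsBalanced v i 0 univ :=
  ⟨mem_univ i, fun _ _ => Nat.le_mul_of_pos_left _ (by norm_num),
    fun _ ht ht' => absurd ht' ht.not_gt⟩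

open Classical in
theorem exists_two_pow_le_card_isBalanced {n : ℕ} [NeZero n] {v : Fin n → ℝ}
    (hv : ∀ i, 0 ≤ v i) : ∃ i r, 0 ≤ r ∧ r ≤ v i ∧ (∀ j, j ≠ i → v j ≤ r) ∧
      (2 : ℝ) ^ n ≤ 5 * #{S : Finset (Fin n) | IsBalanced v i r S} := by
  obtain ⟨i, hi⟩ := Finite.exists_max v
  rcases (univ.erase i).eq_empty_or_nonempty with hempty | hnonempty
  · have hall (j : Fin n) : j = i := of_not_not fun hj =>
      notMem_empty j (hempty ▸ mem_erase.2 ⟨hj, mem_univ j⟩)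
    refine ⟨i, 0, le_rfl, hv i, fun j hj => absurd (hall j) hj, ?_⟩
    have hn : n = 1 := by
      simpa using Fintype.card_eq_one_iff.2 ⟨i, hall⟩
    have hpos : 1 ≤ #{S : Finset (Fin n) | IsBalanced v i 0 S} :=
      card_pos.2 ⟨univ, mem_filter_univ _ |>.2 (isBalanced_univ_zero v i)⟩
    calc (2 : ℝ) ^ n ≤ 5 * (1 : ℕ) := by norm_num [hn]
      _ ≤ 5 * #{S : Finset (Fin n) | IsBalanced v i 0 S} := by gcongr
  · obtain ⟨j, hj, hmax⟩ := exists_max_image _ v hnonempty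
    have hle (l : Fin n) (hl : l ≠ i) : v l ≤ v j := hmax l (mem_erase.2 ⟨hl, mem_univ l⟩)
    exact ⟨i, v j, hv j, hi j, hle,
      two_pow_le_card_isBalanced (ne_of_mem_erase hj).symm (hi j) hle⟩

variable {n k : ℕ} {v : Fin n → ℝ} {price : Finset (Fin n) → ℝ}

theorem rsol_term_nonneg (hv : ∀ i, 0 ≤ v i) (k : ℕ) (S : Finset (Fin n)) (p : ℝ) :
    0 ≤ 1 / 2 * lottery k v S p + 1 / 2 * vickrey k v S :=
  add_nonneg (mul_nonneg (by norm_num) (lottery_nonneg k v S p))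
    (mul_nonneg (by norm_num) (vickrey_nonneg hv k S))

theorem lottery_le_rsol (hk : 1 ≤ k) (hv : ∀ i, 0 ≤ v i)
    (hprice : ∀ T, IsOptimalPrice k v T (price T)) {p : ℝ} (hp : 0 ≤ p) :
    lottery k v univ p ≤ 40960 * rsol k v price := by
  classical
  rcases n.eq_zero_or_pos with rfl | hn
  · rw [lottery_eq, excess, univ_eq_empty, sum_empty, mul_zero]
    exact mul_nonneg (by norm_num) (expect_nonneg fun S _ => rsol_term_nonneg hv k S _)
  have : NeZero n := ⟨hn.ne'⟩
  obtain ⟨i, r, hr, hri, hle, hcard⟩ := exists_two_pow_le_card_isBalanced hv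
  have hsum : 2 ^ n * lottery k v univ p ≤ 40960 * ∑ S : Finset (Fin n),
      (1 / 2 * lottery k v S (price Sᶜ) + 1 / 2 * vickrey k v S) :=
    calc 2 ^ n * lottery k v univ p
        ≤ 5 * #{S : Finset (Fin n) | IsBalanced v i r S} * lottery k v univ p := by
          gcongr
          exact lottery_nonneg k v univ p
      _ = 5 * ∑ S : Finset (Fin n) with IsBalanced v i r S, lottery k v univ p := by
          rw [sum_const, nsmul_eq_mul, mul_assoc]
      _ ≤ 5 * ∑ S : Finset (Fin n) with IsBalanced v i r S,
            8192 * (1 / 2 * lottery k v S (price Sᶜ) + 1 / 2 * vickrey k v S) := by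
          gcongr with S hS
          exact ((mem_filter_univ S).1 hS).lottery_le hk hv hr hri hle hp (hprice Sᶜ)
      _ ≤ 5 * ∑ S : Finset (Fin n),
            8192 * (1 / 2 * lottery k v S (price Sᶜ) + 1 / 2 * vickrey k v S) := by
          refine mul_le_mul_of_nonneg_left (sum_le_univ_sum_of_nonneg fun S => ?_) (by norm_num)
          exact mul_nonneg (by norm_num) (rsol_term_nonneg hv k S _)
      _ = 40960 * ∑ S : Finset (Fin n),
            (1 / 2 * lottery k v S (price Sᶜ) + 1 / 2 * vickrey k v S) := by
          rw [← mul_sum]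
          ring
  rw [rsol, Fintype.expect_eq_sum_div_card, Fintype.card_finset, Fintype.card_fin, Nat.cast_pow,
    Nat.cast_ofNat, ← mul_div_assoc, le_div_iff₀' (by positivity)]
  exact hsum

theorem mainTheorem2_general (hk : 1 ≤ k) (hv : ∀ i, 0 ≤ v i)
    (hprice : ∀ T, IsOptimalPrice k v T (price T)) {θ : ℝ → ℝ} (hθ : Monotone θ) :
    residualSurplus k θ v ≤ 81920 * rsol k v price := by
  obtain ⟨p, q, hp, hq, hpq⟩ := exists_residualSurplus_le_lottery_add_lottery hk hθ hv
  calc residualSurplus k θ v ≤ lottery k v univ p + lottery k v univ q := hpq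
    _ ≤ 40960 * rsol k v price + 40960 * rsol k v price :=
        add_le_add (lottery_le_rsol hk hv hprice hp) (lottery_le_rsol hk hv hprice hq)
    _ = 81920 * rsol k v price := by ring

end RSOL

end MoneyBurning

end

theorem mainTheorem2 :
    ∃ β : ℝ, 0 < β ∧
      ∀ (n k : ℕ), 1 ≤ k →
      ∀ v : Fin n → ℝ, (∀ i, 0 ≤ v i) →
      ∀ price : Finset (Fin n) → ℝ,
        (∀ T : Finset (Fin n), MoneyBurning.IsOptimalPrice k v T (price T)) →
        MoneyBurning.benchmark k v ≤ ((β * MoneyBurning.rsol k v price : ℝ) : EReal) :=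
  ⟨81920, by norm_num, fun _ _ hk _ hv _ hprice => iSup_le fun P => EReal.coe_le_coe_iff.2
    (MoneyBurning.mainTheorem2_general hk hv hprice P.monotone_ironed)⟩
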